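/- Let $\mathbb{D}=\{z\in\mathbb{C}:|z|<1\}$, let $n\ge 4$ be an even integer, and let $\varphi_{n\mathcal{L}}(z)=1+\frac{n}{n+1}z+\frac{1}{n+1}z^n$. Let $\mathcal{S}^*_{n\mathcal{L}}$ be the class of all functions $f$ that are analytic and injective on $\mathbb{D}$, satisfy $f(0)=0$ and $f'(0)=1$, and for which $zf'(z)/f(z)\prec\varphi_{n\mathcal{L}}(z)$; that is, there is an analytic function $w:\mathbb{D}\to\mathbb{D}$ with $w(0)=0$ and $zf'(z)/f(z)=\varphi_{n\mathcal{L}}(w(z))$ for all $z\in\mathbb{D}$, where the left-hand side is given its limiting value $1$ at $z=0$. If $f(z)=z+a_2z^2+a_3z^3+\cdots$ belongs to $\mathcal{S}^*_{n\mathcal{L}}$, then $$|a_2|\le\frac{n}{n+1},\qquad |a_3|\le\frac{n}{2(n+1)},\qquad |a_4|\le\frac{n}{3(n+1)},\qquad |a_5|\le\frac{n}{4(n+1)}.$$ All four bounds are sharp: for $i=2,3,4,5$ the function $$f_i(z)=z\exp\left(\int_0^z\frac{\varphi_{n\mathcal{L}}(t^{i-1})-1}{t}\,dt\right)$$ belongs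 to $\mathcal{S}^*_{n\mathcal{L}}$, and equality holds in the bound on $|a_i|$ for $f=f_i$. -/

import Mathlib

noncomputable section

namespace EpicycloidStarlike

/-- The open unit disk of the complex plane. -/
def unitDisk : Set ℂ := Metric.ball 0 1

/-- The class of normalized univalent functions on the unit disk: `f` is analytic and injective
on the disk, `f 0 = 0` and `f' 0 = 1`.  Values of `f` outside the disk are irrelevant. -/
structure IsNormalizedUnivalent (f : ℂ → ℂ) : Prop where
  analytic : DifferentiableOn ℂ f unitDisk
  injective : Set.InjOn f unitDisk
  map_zero : f 0 = 0
  deriv_zero : deriv f 0 = 1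

/-- Subordination `g ≺ h` on the unit disk: `g = h ∘ w` on the disk for an analytic self-map `w`
of the disk with `w 0 = 0`. -/
def Subordinate (g h : ℂ → ℂ) : Prop :=
  ∃ w : ℂ → ℂ, DifferentiableOn ℂ w unitDisk ∧ Set.MapsTo w unitDisk unitDisk ∧ w 0 = 0 ∧
    ∀ z ∈ unitDisk, g z = h (w z)

/-- The function `z f'(z) / f(z)`, with its removable singularity at the origin filled in by the
value `1` (the limit there when `f 0 = 0` and `f' 0 = 1`). -/
def starQuotient (f : ℂ → ℂ) (z : ℂ) : ℂ :=
  if z = 0 then 1 else z * deriv f z / f z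

/-- The Ma–Minda class `S*(φ)`. -/
def maMindaClass (φ : ℂ → ℂ) : Set (ℂ → ℂ) :=
  {f | IsNormalizedUnivalent f ∧ Subordinate (starQuotient f) φ}

/-- `φ_{nL}(z) = 1 + n z / (n + 1) + z ^ n / (n + 1)`. -/
def phi (n : ℕ) (z : ℂ) : ℂ := 1 + n * z / (n + 1) + z ^ n / (n + 1)

/-- The class `S*_{nL} = S*(φ_{nL})`. -/
def starlikeClass (n : ℕ) : Set (ℂ → ℂ) := maMindaClass (phi n)

/-- The coefficient `a_k` of `z ^ k` in the Taylor expansion of `f` at the origin. -/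
def taylorCoeff (f : ℂ → ℂ) (k : ℕ) : ℂ := iteratedDeriv k f 0 / (k.factorial : ℂ)

/-- The integral of `g` from `0` to `z` along the segment `t = s z`, `0 ≤ s ≤ 1`. -/
def segmentIntegral (g : ℂ → ℂ) (z : ℂ) : ℂ := ∫ s in (0 : ℝ)..1, g (s * z) * z

/-- `f_i(z) = z exp (∫_0^z (φ_{nL}(t ^ (i - 1)) - 1) / t dt)`, used for `i ≥ 2`. -/
def extremal (n i : ℕ) (z : ℂ) : ℂ :=
  z * Complex.exp (segmentIntegral (fun t => (phi n (t ^ (i - 1)) - 1) / t) z)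

end EpicycloidStarlike

end

/-!
Let `A = n / (n + 1)`. A member `f` of the class satisfies `z f' = f · φ(w)` with an analytic
self-map `w = c₁ z + c₂ z² + ⋯` of the disk, and comparing Taylor coefficients
(`taylorCoeff_eq_of_mul_deriv_eq`) turns each `a_k`, `2 ≤ k ≤ 5`, into
`A / (k - 1)` times a polynomial in the `c_j`, namely

* `c₁`, `c₂ + A c₁²`, `c₃ + (3/2) A c₁ c₂ + (A²/2) c₁³`,
* `c₄ + (4/3) A c₁ c₃ + (A/2) c₂² + A² c₁² c₂ + (A³/6 + ε) c₁⁴`,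

where `ε = 1/4` if `n = 4` and `ε = 0` otherwise. The claim is that each has modulus at most `1`.

The only fact used about `w` is that multiplication by `w` is a contraction of the Hardy space
`H²`, in truncated form (`sum_normSq_mul_polynomial_le`, from Cauchy's formula and Bessel's
inequality on circles). For a polynomial `h = 1 + h₁ z + h₂ z² + h₃ z³` it bounds the coefficient
of `z⁴` in `w h` by the norm of `h` and the lower coefficients of `w h`. The `h_j` are chosen as
polynomials in the `c_j` so that this coefficient is the functional above; it then has modulus at
most `1` as soon as the lower coefficients of `w h` compensate `h₁, h₂, h₃`. After minimizing over
`c₃` this is the nonnegativity of a binary quadratic form in `c₂` and `c₁²`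
(`norm_third_functional_le`, `norm_fourth_functional_le`), a numerical condition on `A`.

For sharpness, `f_{m+1}` is `z * exp (G z)` with a polynomial `G`, and satisfies
`z f' = f · φ(z ^ m)`, so the coefficient formulas with `w = z ^ m` give equality. Univalence
(`injOn_extremal`) follows by passing to logarithms: `u ↦ G (exp u)` is a strict contraction on
closed half-planes inside the left half-plane.
-/

namespace EpicycloidStarlike

/-! ### Taylor coefficients as formal power series -/

/-- The Taylor series of `f` at the origin, as a formal power series. -/
noncomputable def taylorSeries (f : ℂ → ℂ) : PowerSeries ℂ := PowerSeries.mk (taylorCoeff f)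

lemma coeff_taylorSeries (f : ℂ → ℂ) (k : ℕ) :
    PowerSeries.coeff k (taylorSeries f) = taylorCoeff f k := PowerSeries.coeff_mk _ _

lemma taylorSeries_congr {f g : ℂ → ℂ} (h : f =ᶠ[nhds 0] g) :
    taylorSeries f = taylorSeries g := by
  ext k
  rw [coeff_taylorSeries, coeff_taylorSeries, taylorCoeff, taylorCoeff, h.iteratedDeriv_eq]

lemma taylorSeries_add {f g : ℂ → ℂ} (hf : AnalyticAt ℂ f 0) (hg : AnalyticAt ℂ g 0) :
    taylorSeries (fun z => f z + g z) = taylorSeries f + taylorSeries g := by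
  ext k
  simp only [map_add, coeff_taylorSeries, taylorCoeff]
  rw [← add_div, ← iteratedDeriv_add hf.contDiffAt hg.contDiffAt]
  rfl

lemma taylorSeries_mul {f g : ℂ → ℂ} (hf : AnalyticAt ℂ f 0) (hg : AnalyticAt ℂ g 0) :
    taylorSeries (fun z => f z * g z) = taylorSeries f * taylorSeries g := by
  ext k
  rw [PowerSeries.coeff_mul, Finset.Nat.sum_antidiagonal_eq_sum_range_succ_mk]
  simp only [coeff_taylorSeries, taylorCoeff]
  rw [iteratedDeriv_fun_mul hf.contDiffAt hg.contDiffAt, Finset.sum_div]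
  refine Finset.sum_congr rfl fun i hi => ?_
  have hik : i ≤ k := Nat.lt_succ_iff.mp (Finset.mem_range.mp hi)
  rw [Nat.cast_choose ℂ hik]
  have h1 : (i.factorial : ℂ) ≠ 0 := by exact_mod_cast i.factorial_ne_zero
  have h2 : ((k - i).factorial : ℂ) ≠ 0 := by exact_mod_cast (k - i).factorial_ne_zero
  have h3 : (k.factorial : ℂ) ≠ 0 := by exact_mod_cast k.factorial_ne_zero
  field_simp

lemma taylorSeries_const (c : ℂ) : taylorSeries (fun _ => c) = PowerSeries.C c := by
  ext k
  rw [coeff_taylorSeries, taylorCoeff, iteratedDeriv_const, PowerSeries.coeff_C]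
  split_ifs with h <;> simp [h]

lemma taylorSeries_id : taylorSeries (fun z => z) = PowerSeries.X := by
  ext k
  rw [coeff_taylorSeries, taylorCoeff, iteratedDeriv_fun_id_zero, PowerSeries.coeff_X]
  split_ifs with h <;> simp [h]

lemma taylorSeries_pow {f : ℂ → ℂ} (hf : AnalyticAt ℂ f 0) (m : ℕ) :
    taylorSeries (fun z => f z ^ m) = taylorSeries f ^ m := by
  induction m with
  | zero => simp [taylorSeries_const]
  | succ m ih =>
    simp only [pow_succ]
    rw [taylorSeries_mul (f := fun z => f z ^ m) (hf.pow m) hf, ih]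

lemma taylorCoeff_pow (m k : ℕ) : taylorCoeff (fun z => z ^ m) k = if k = m then 1 else 0 := by
  rw [← coeff_taylorSeries, taylorSeries_pow (f := fun z => z) analyticAt_id, taylorSeries_id,
    PowerSeries.coeff_X_pow]

lemma taylorCoeff_deriv (f : ℂ → ℂ) (k : ℕ) :
    taylorCoeff (deriv f) k = (k + 1) * taylorCoeff f (k + 1) := by
  rw [taylorCoeff, taylorCoeff, iteratedDeriv_succ', Nat.factorial_succ]
  have h3 : (k.factorial : ℂ) ≠ 0 := by exact_mod_cast k.factorial_ne_zero
  have h4 : (k : ℂ) + 1 ≠ 0 := by exact_mod_cast k.succ_ne_zero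
  push_cast
  field_simp

/-- The Taylor coefficients of a polynomial function, given by its coefficient sequence, are
its coefficients. -/
lemma taylorCoeff_polynomial (b : ℕ → ℂ) (N : ℕ) (k : ℕ) :
    taylorCoeff (fun z => ∑ j ∈ Finset.range N, b j * z ^ j) k = if k < N then b k else 0 := by
  rw [← coeff_taylorSeries]
  have h : taylorSeries (fun z => ∑ j ∈ Finset.range N, b j * z ^ j)
      = ∑ j ∈ Finset.range N, PowerSeries.C (b j) * PowerSeries.X ^ j := by
    induction N with
    | zero => simpa using taylorSeries_const 0
    | succ N ih =>
      simp only [Finset.sum_range_succ]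
      rw [taylorSeries_add (by fun_prop) (by fun_prop), ih,
        taylorSeries_mul (by fun_prop) (by fun_prop), taylorSeries_const,
        taylorSeries_pow (by fun_prop), taylorSeries_id]
  rw [h, map_sum]
  simp [PowerSeries.coeff_C_mul, PowerSeries.coeff_X_pow]

/-! ### Bessel's inequality on circles and contractivity of multiplication by a Schur function -/

/-- Cauchy's formula for the Taylor coefficients, as a circle average. On the circle `|z| = r`
the conjugate of `z ^ k` equals `r ^ (2 * k) / z ^ k`. -/
lemma circleAverage_mul_conj_pow {g : ℂ → ℂ} {r : ℝ} (hr : 0 < r)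
    (hg : DifferentiableOn ℂ g (Metric.closedBall 0 r)) (k : ℕ) :
    Real.circleAverage (fun z => g z * (starRingEnd ℂ) (z ^ k)) 0 r
      = (r : ℂ) ^ (2 * k) * taylorCoeff g k := by
  have h1 : Real.circleAverage (fun z => g z * (starRingEnd ℂ) (z ^ k)) 0 r
      = Real.circleAverage (fun z => (r : ℂ) ^ (2 * k) • ((1 / z ^ k) * g z)) 0 r := by
    refine Real.circleAverage_congr_sphere fun z hz => ?_
    rw [abs_of_pos hr, mem_sphere_zero_iff_norm] at hz
    have hz0 : z ≠ 0 := by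
      rintro rfl
      simp at hz
      exact hr.ne hz
    have h2 : z * (starRingEnd ℂ) z = (r : ℂ) ^ 2 := by
      rw [Complex.mul_conj, Complex.normSq_eq_norm_sq, hz]
      push_cast
      rfl
    have h3 : z ^ k * (starRingEnd ℂ) (z ^ k) = (r : ℂ) ^ (2 * k) := by
      rw [map_pow, ← mul_pow, h2, pow_mul]
    simp only [smul_eq_mul]
    rw [← h3]
    field_simp
  rw [h1, Real.circleAverage_fun_smul, Real.circleAverage_eq_circleIntegral hr.ne', smul_eq_mul,
    taylorCoeff]
  congr 1
  have h4 := hg.circleIntegral_one_div_sub_center_pow_smul hr k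
  have h5 : (∮ z in C(0, r), (z - 0)⁻¹ • (1 / z ^ k * g z))
      = ∮ z in C(0, r), (1 / (z - 0) ^ (k + 1)) • g z := by
    congr 1
    ext z
    simp only [sub_zero, smul_eq_mul, pow_succ, one_div, mul_inv]
    ring
  rw [h5, h4, smul_eq_mul, smul_eq_mul]
  have := Complex.two_pi_I_ne_zero
  field_simp

lemma circleAverage_mul_conj_polynomial {g : ℂ → ℂ} {r : ℝ} (hr : 0 < r)
    (hg : DifferentiableOn ℂ g (Metric.closedBall 0 r)) (b : ℕ → ℂ) (N : ℕ) :
    Real.circleAverage (fun z => g z * (starRingEnd ℂ) (∑ j ∈ Finset.range N, b j * z ^ j)) 0 r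
      = ∑ j ∈ Finset.range N, (starRingEnd ℂ) (b j) * ((r : ℂ) ^ (2 * j) * taylorCoeff g j) := by
  have hgc : ContinuousOn g (Metric.sphere 0 r) :=
    hg.continuousOn.mono Metric.sphere_subset_closedBall
  have h1 : (fun z => g z * (starRingEnd ℂ) (∑ j ∈ Finset.range N, b j * z ^ j))
      = fun z => ∑ j ∈ Finset.range N,
          (starRingEnd ℂ) (b j) • (g z * (starRingEnd ℂ) (z ^ j)) := by
    ext z
    simp only [map_sum, map_mul, Finset.mul_sum, smul_eq_mul]
    refine Finset.sum_congr rfl fun j _ => ?_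
    ring
  rw [h1, Real.circleAverage_fun_sum]
  · refine Finset.sum_congr rfl fun j _ => ?_
    rw [Real.circleAverage_fun_smul, circleAverage_mul_conj_pow hr hg, smul_eq_mul]
  · intro j _
    refine ContinuousOn.circleIntegrable hr.le ?_
    have : Continuous fun z : ℂ => (starRingEnd ℂ) (z ^ j) := by fun_prop
    have h2 := hgc.mul (this.continuousOn (s := Metric.sphere 0 r))
    exact ContinuousOn.const_smul h2 ((starRingEnd ℂ) (b j))

/-- Parseval's identity for polynomials on a circle of radius `r`. -/
lemma circleAverage_normSq_polynomial {r : ℝ} (hr : 0 < r) (b : ℕ → ℂ) (N : ℕ) :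
    Real.circleAverage (fun z => Complex.normSq (∑ j ∈ Finset.range N, b j * z ^ j)) 0 r
      = ∑ j ∈ Finset.range N, r ^ (2 * j) * Complex.normSq (b j) := by
  have hd : Differentiable ℂ fun z : ℂ => ∑ j ∈ Finset.range N, b j * z ^ j := by fun_prop
  have hc := hd.continuous
  have hcc : Continuous fun z => (starRingEnd ℂ) (∑ j ∈ Finset.range N, b j * z ^ j) :=
    Complex.continuous_conj.comp hc
  have h := circleAverage_mul_conj_polynomial hr hd.differentiableOn b N
  have h2 := Complex.reCLM.circleAverage_comp_comm (f := fun z =>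
    (∑ j ∈ Finset.range N, b j * z ^ j) * (starRingEnd ℂ) (∑ j ∈ Finset.range N, b j * z ^ j))
    (c := 0) (R := r) ((hc.mul hcc).continuousOn.circleIntegrable hr.le)
  rw [h] at h2
  have h3 : (Complex.reCLM ∘ fun z => (∑ j ∈ Finset.range N, b j * z ^ j) *
      (starRingEnd ℂ) (∑ j ∈ Finset.range N, b j * z ^ j))
      = fun z => Complex.normSq (∑ j ∈ Finset.range N, b j * z ^ j) := by
    ext z
    simp [Complex.mul_conj, -map_sum]
  rw [h3] at h2
  rw [h2]
  simp only [map_sum]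
  refine Finset.sum_congr rfl fun j hj => ?_
  rw [taylorCoeff_polynomial, if_pos (Finset.mem_range.mp hj), Complex.reCLM_apply,
    show (starRingEnd ℂ) (b j) * ((r : ℂ) ^ (2 * j) * b j)
      = ((r ^ (2 * j) * Complex.normSq (b j) : ℝ) : ℂ) by
      push_cast
      rw [← Complex.mul_conj]
      ring, Complex.ofReal_re]

/-- Bessel's inequality on the circle `|z| = r`: it expresses that
`‖g - p‖² ≥ 0` in `L²` for the Taylor polynomial `p` of `g`. -/
lemma sum_normSq_taylorCoeff_le {g : ℂ → ℂ} {r : ℝ} (hr : 0 < r)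
    (hg : DifferentiableOn ℂ g (Metric.closedBall 0 r)) (N : ℕ) :
    ∑ j ∈ Finset.range N, r ^ (2 * j) * Complex.normSq (taylorCoeff g j)
      ≤ Real.circleAverage (fun z => Complex.normSq (g z)) 0 r := by
  set p : ℂ → ℂ := fun z => ∑ j ∈ Finset.range N, taylorCoeff g j * z ^ j with hp
  have hgc : ContinuousOn g (Metric.sphere 0 r) :=
    hg.continuousOn.mono Metric.sphere_subset_closedBall
  have hpc : Continuous p := by fun_prop
  have hpcc : Continuous fun z => (starRingEnd ℂ) (p z) := Complex.continuous_conj.comp hpc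
  have hgp : ContinuousOn (fun z => g z * (starRingEnd ℂ) (p z)) (Metric.sphere 0 r) :=
    hgc.mul hpcc.continuousOn
  have hre := Complex.reCLM.circleAverage_comp_comm (c := 0) (R := r)
    (hgp.circleIntegrable hr.le)
  rw [circleAverage_mul_conj_polynomial hr hg] at hre
  have hre' : Complex.reCLM (∑ j ∈ Finset.range N, (starRingEnd ℂ) (taylorCoeff g j) *
      ((r : ℂ) ^ (2 * j) * taylorCoeff g j))
      = ∑ j ∈ Finset.range N, r ^ (2 * j) * Complex.normSq (taylorCoeff g j) := by
    rw [map_sum]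
    refine Finset.sum_congr rfl fun j _ => ?_
    rw [Complex.reCLM_apply,
      show (starRingEnd ℂ) (taylorCoeff g j) * ((r : ℂ) ^ (2 * j) * taylorCoeff g j)
        = ((r ^ (2 * j) * Complex.normSq (taylorCoeff g j) : ℝ) : ℂ) by
        push_cast
        rw [← Complex.mul_conj]
        ring, Complex.ofReal_re]
  rw [hre'] at hre
  have hpp := circleAverage_normSq_polynomial hr (taylorCoeff g) N
  have hnn : 0 ≤ Real.circleAverage (fun z => Complex.normSq (g z - p z)) 0 r :=
    Real.circleAverage_nonneg_of_nonneg fun z _ => Complex.normSq_nonneg _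
  have i1 : CircleIntegrable (fun z => Complex.normSq (g z)) 0 r :=
    (Complex.continuous_normSq.comp_continuousOn hgc).circleIntegrable hr.le
  have i2 : CircleIntegrable (fun z => Complex.normSq (p z)) 0 r :=
    (Complex.continuous_normSq.comp hpc).continuousOn.circleIntegrable hr.le
  have i3 : CircleIntegrable (Complex.reCLM ∘ fun z => g z * (starRingEnd ℂ) (p z)) 0 r :=
    (Complex.reCLM.continuous.comp_continuousOn hgp).circleIntegrable hr.le
  have hexp : (fun z => Complex.normSq (g z - p z)) = fun z =>
      (Complex.normSq (g z) + Complex.normSq (p z))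
        - (2 : ℝ) • (Complex.reCLM ∘ fun z => g z * (starRingEnd ℂ) (p z)) z := by
    ext z
    simp [Complex.normSq_sub]
  have i4 : CircleIntegrable (fun z => Complex.normSq (g z) + Complex.normSq (p z)) 0 r := i1.add i2
  have i5 : CircleIntegrable (fun z => (2 : ℝ) •
      (Complex.reCLM ∘ fun z => g z * (starRingEnd ℂ) (p z)) z) 0 r := i3.const_smul
  rw [hexp, Real.circleAverage_fun_sub i4 i5,
    Real.circleAverage_fun_add i1 i2, Real.circleAverage_fun_smul, hre, hpp, smul_eq_mul] at hnn
  linarith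

/-- The lower triangular Toeplitz matrix of the Taylor coefficients of a function bounded by `1`
on the disk is a contraction. -/
lemma sum_normSq_mul_polynomial_le {w : ℂ → ℂ} (hw : DifferentiableOn ℂ w unitDisk)
    (hmaps : Set.MapsTo w unitDisk unitDisk) (b : ℕ → ℂ) (N : ℕ) :
    ∑ k ∈ Finset.range N, Complex.normSq (∑ j ∈ Finset.range (k + 1), b j * taylorCoeff w (k - j))
      ≤ ∑ k ∈ Finset.range N, Complex.normSq (b k) := by
  have key : ∀ r : ℝ, r ∈ Set.Ioo (0 : ℝ) 1 →
      ∑ k ∈ Finset.range N, r ^ (2 * k) *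
          Complex.normSq (∑ j ∈ Finset.range (k + 1), b j * taylorCoeff w (k - j))
        ≤ ∑ k ∈ Finset.range N, r ^ (2 * k) * Complex.normSq (b k) := by
    rintro r ⟨hr0, hr1⟩
    set p : ℂ → ℂ := fun z => ∑ j ∈ Finset.range N, b j * z ^ j with hp
    have hpd : Differentiable ℂ p := by fun_prop
    have hsub : Metric.closedBall (0 : ℂ) r ⊆ unitDisk := Metric.closedBall_subset_ball hr1
    have hg : DifferentiableOn ℂ (fun z => p z * w z) (Metric.closedBall 0 r) :=
      hpd.differentiableOn.mul (hw.mono hsub)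
    have h1 := sum_normSq_taylorCoeff_le hr0 hg N
    have hw0 : AnalyticAt ℂ w 0 :=
      hw.analyticAt (Metric.isOpen_ball.mem_nhds (Metric.mem_ball_self one_pos))
    have h2 : ∀ k ∈ Finset.range N, taylorCoeff (fun z => p z * w z) k
        = ∑ j ∈ Finset.range (k + 1), b j * taylorCoeff w (k - j) := by
      intro k hk
      rw [← coeff_taylorSeries, taylorSeries_mul (hpd.analyticAt 0) hw0, PowerSeries.coeff_mul,
        Finset.Nat.sum_antidiagonal_eq_sum_range_succ_mk]
      refine Finset.sum_congr rfl fun j hj => ?_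
      rw [coeff_taylorSeries, coeff_taylorSeries, taylorCoeff_polynomial, if_pos]
      have := Finset.mem_range.mp hj
      have := Finset.mem_range.mp hk
      omega
    have h3 : Real.circleAverage (fun z => Complex.normSq (p z * w z)) 0 r
        ≤ Real.circleAverage (fun z => Complex.normSq (p z)) 0 r := by
      refine Real.circleAverage_mono ?_ ?_ ?_
      · exact (Complex.continuous_normSq.comp_continuousOn
          (hg.continuousOn.mono Metric.sphere_subset_closedBall)).circleIntegrable hr0.le
      · exact (Complex.continuous_normSq.comp hpd.continuous).continuousOn.circleIntegrable hr0.le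
      · intro z hz
        rw [abs_of_pos hr0] at hz
        have hwz := hmaps (hsub (Metric.sphere_subset_closedBall hz))
        rw [unitDisk, mem_ball_zero_iff] at hwz
        rw [Complex.normSq_mul, Complex.normSq_eq_norm_sq (w z)]
        exact mul_le_of_le_one_right (Complex.normSq_nonneg _)
          (pow_le_one₀ (norm_nonneg _) hwz.le)
    rw [circleAverage_normSq_polynomial hr0] at h3
    refine le_trans (le_of_eq ?_) (h1.trans h3)
    exact Finset.sum_congr rfl fun k hk => by rw [h2 k hk]
  -- Let `r` tend to `1` from the left.
  have hlim : ∀ c : ℕ → ℝ, Filter.Tendsto (fun r : ℝ => ∑ k ∈ Finset.range N, r ^ (2 * k) * c k)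
      (nhdsWithin 1 (Set.Iio 1)) (nhds (∑ k ∈ Finset.range N, c k)) := by
    intro c
    have : Continuous fun r : ℝ => ∑ k ∈ Finset.range N, r ^ (2 * k) * c k := by fun_prop
    simpa using (this.tendsto 1).mono_left nhdsWithin_le_nhds
  refine le_of_tendsto_of_tendsto (hlim _) (hlim _) ?_
  filter_upwards [Ioo_mem_nhdsLT (show (0 : ℝ) < 1 by norm_num)] with r hr using key r hr

/-! ### The coefficients of a starlike function in terms of the subordinating function -/

lemma analyticAt_phi (n : ℕ) (z : ℂ) : AnalyticAt ℂ (phi n) z := by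
  have h : Differentiable ℂ (phi n) := by unfold phi; fun_prop
  exact h.analyticAt z

/-- If `z f' = f · φ(w)` near the origin, then comparing Taylor coefficients expresses
`a₂, …, a₅` through the coefficients of `w`.  The term `w ^ n` of `φ(w)` has order at least `n`,
so it is visible in these coefficients only for `n = 4`, and there only in `a₅`. -/
lemma taylorCoeff_eq_of_mul_deriv_eq {n : ℕ} (hn : 4 ≤ n) {f w : ℂ → ℂ}
    (hf : AnalyticAt ℂ f 0) (hf0 : f 0 = 0) (hf1 : deriv f 0 = 1)
    (hw : AnalyticAt ℂ w 0) (hw0 : w 0 = 0)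
    (h : ∀ᶠ z in nhds 0, z * deriv f z = f z * phi n (w z)) {A ε : ℂ}
    (hA : A = n / (n + 1)) (hε : ε = if n = 4 then 1 / 4 else 0) :
    taylorCoeff f 2 = A * taylorCoeff w 1 ∧
    taylorCoeff f 3 = A / 2 * (taylorCoeff w 2 + A * taylorCoeff w 1 ^ 2) ∧
    taylorCoeff f 4 = A / 3 * (taylorCoeff w 3 + 3 / 2 * A * taylorCoeff w 1 * taylorCoeff w 2
      + A ^ 2 / 2 * taylorCoeff w 1 ^ 3) ∧
    taylorCoeff f 5 = A / 4 * (taylorCoeff w 4 + 4 / 3 * A * taylorCoeff w 1 * taylorCoeff w 3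
      + A / 2 * taylorCoeff w 2 ^ 2 + A ^ 2 * taylorCoeff w 1 ^ 2 * taylorCoeff w 2
      + (A ^ 3 / 6 + ε) * taylorCoeff w 1 ^ 4) := by
  have hn1 : (n : ℂ) + 1 ≠ 0 := by exact_mod_cast n.succ_ne_zero
  have ha0 : taylorCoeff f 0 = 0 := by simp [taylorCoeff, hf0]
  have ha1 : taylorCoeff f 1 = 1 := by simp [taylorCoeff, hf1]
  have hc0 : taylorCoeff w 0 = 0 := by simp [taylorCoeff, hw0]
  -- The Taylor series of `φ ∘ w`.
  have hphi : taylorSeries (fun z => phi n (w z)) = 1 + PowerSeries.C A * taylorSeries w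
      + PowerSeries.C (1 / (n + 1) : ℂ) * taylorSeries w ^ n := by
    have e : (fun z => phi n (w z)) = fun z => (1 + A * w z) + (1 / (n + 1) : ℂ) * w z ^ n := by
      ext z
      rw [phi, hA]
      ring
    have hwn : AnalyticAt ℂ (fun z => w z ^ n) 0 := hw.pow n
    rw [e, taylorSeries_add (f := fun z => 1 + A * w z) (by fun_prop) (by fun_prop),
      taylorSeries_add (by fun_prop) (by fun_prop), taylorSeries_mul (by fun_prop) hw,
      taylorSeries_mul (by fun_prop) hwn, taylorSeries_pow hw, taylorSeries_const,
      taylorSeries_const, taylorSeries_const, map_one]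
  have hmain : PowerSeries.X * taylorSeries (deriv f)
      = taylorSeries f * taylorSeries (fun z => phi n (w z)) := by
    have hphiw : AnalyticAt ℂ (fun z => phi n (w z)) 0 := (analyticAt_phi n (w 0)).comp hw
    rw [← taylorSeries_mul hf hphiw, ← taylorSeries_congr h,
      taylorSeries_mul (by fun_prop) hf.deriv, taylorSeries_id]
  -- The low order coefficients of `w ^ n`.
  obtain ⟨V, hV⟩ : PowerSeries.X ∣ taylorSeries w := by
    rw [PowerSeries.X_dvd_iff, ← PowerSeries.coeff_zero_eq_constantCoeff_apply,
      coeff_taylorSeries, hc0]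
  have hV0 : PowerSeries.coeff 0 V = taylorCoeff w 1 := by
    rw [← coeff_taylorSeries, hV, ← zero_add 1, PowerSeries.coeff_succ_X_mul]
  have hpow : ∀ k, PowerSeries.coeff k (taylorSeries w ^ n)
      = if n ≤ k then PowerSeries.coeff (k - n) (V ^ n) else 0 := by
    intro k
    rw [hV, mul_pow, PowerSeries.coeff_X_pow_mul']
  have hpow_lt : ∀ k < 4, PowerSeries.coeff k (taylorSeries w ^ n) = 0 := fun k hk => by
    rw [hpow, if_neg (by omega)]
  have hpow4 : 1 / ((n : ℂ) + 1) * PowerSeries.coeff 4 (taylorSeries w ^ n)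
      = A * ε * taylorCoeff w 1 ^ 4 := by
    rcases eq_or_ne n 4 with rfl | h4
    · rw [hpow, if_pos le_rfl, Nat.sub_self, PowerSeries.coeff_zero_eq_constantCoeff_apply,
        map_pow, ← PowerSeries.coeff_zero_eq_constantCoeff_apply, hV0, hA, hε, if_pos rfl]
      norm_num
    · rw [hpow, if_neg (by omega), hε, if_neg h4]
      ring
  set P := taylorSeries (fun z => phi n (w z)) with hP
  have hPk : ∀ k, PowerSeries.coeff (k + 1) P = A * taylorCoeff w (k + 1)
      + 1 / ((n : ℂ) + 1) * PowerSeries.coeff (k + 1) (taylorSeries w ^ n) := by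
    intro k
    rw [hphi, map_add, map_add, PowerSeries.coeff_C_mul, PowerSeries.coeff_C_mul,
      coeff_taylorSeries, PowerSeries.coeff_one, if_neg k.succ_ne_zero, zero_add]
  have hP0 : PowerSeries.coeff 0 P = 1 := by
    rw [hphi, map_add, map_add, PowerSeries.coeff_C_mul, PowerSeries.coeff_C_mul,
      coeff_taylorSeries, PowerSeries.coeff_one, if_pos rfl, hpow_lt 0 (by norm_num), hc0]
    ring
  have hP1 : PowerSeries.coeff 1 P = A * taylorCoeff w 1 := by
    rw [hPk 0, hpow_lt _ (by norm_num)]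
    ring
  have hP2 : PowerSeries.coeff 2 P = A * taylorCoeff w 2 := by
    rw [hPk 1, hpow_lt _ (by norm_num)]
    ring
  have hP3 : PowerSeries.coeff 3 P = A * taylorCoeff w 3 := by
    rw [hPk 2, hpow_lt _ (by norm_num)]
    ring
  have hP4 : PowerSeries.coeff 4 P = A * taylorCoeff w 4 + A * ε * taylorCoeff w 1 ^ 4 := by
    rw [hPk 3, hpow4]
  have hrec : ∀ k : ℕ, ((k : ℂ) + 1) * taylorCoeff f (k + 1)
      = ∑ j ∈ Finset.range (k + 2), taylorCoeff f j * PowerSeries.coeff (k + 1 - j) P := by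
    intro k
    have := congrArg (PowerSeries.coeff (k + 1)) hmain
    rw [PowerSeries.coeff_succ_X_mul, coeff_taylorSeries, taylorCoeff_deriv,
      PowerSeries.coeff_mul, Finset.Nat.sum_antidiagonal_eq_sum_range_succ_mk] at this
    simpa only [coeff_taylorSeries] using this
  have r2 := hrec 1
  have r3 := hrec 2
  have r4 := hrec 3
  have r5 := hrec 4
  norm_num [Finset.sum_range_succ, ha0, ha1, hP0, hP1, hP2, hP3, hP4] at r2 r3 r4 r5
  have e2 : taylorCoeff f 2 = A * taylorCoeff w 1 := by linear_combination r2
  have e3 : taylorCoeff f 3 = A / 2 * (taylorCoeff w 2 + A * taylorCoeff w 1 ^ 2) := by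
    rw [e2] at r3
    linear_combination r3 / 2
  have e4 : taylorCoeff f 4 = A / 3 * (taylorCoeff w 3
      + 3 / 2 * A * taylorCoeff w 1 * taylorCoeff w 2 + A ^ 2 / 2 * taylorCoeff w 1 ^ 3) := by
    rw [e2, e3] at r4
    linear_combination r4 / 3
  refine ⟨e2, e3, e4, ?_⟩
  rw [e2, e3, e4] at r5
  linear_combination r5 / 4

/-- For a member `f` of the class, `z f' = f · φ(w)` near the origin. -/
lemma eventually_mul_deriv_eq {φ f w : ℂ → ℂ} (hf : IsNormalizedUnivalent f)
    (h : ∀ z ∈ unitDisk, starQuotient f z = φ (w z)) :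
    ∀ᶠ z in nhds 0, z * deriv f z = f z * φ (w z) := by
  have h0 : (0 : ℂ) ∈ unitDisk := Metric.mem_ball_self one_pos
  filter_upwards [Metric.isOpen_ball.mem_nhds h0] with z hz
  have hz' : z ∈ unitDisk := hz
  rcases eq_or_ne z 0 with rfl | hne
  · rw [hf.map_zero]
    ring
  have hfz : f z ≠ 0 := fun he => hne (hf.injective hz' h0 (he.trans hf.map_zero.symm))
  rw [← h z hz', starQuotient, if_neg hne]
  field_simp

/-! ### Coefficient functionals of Schur functions -/

/-- Contractivity of multiplication by `w`, applied to the polynomial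
`1 + h₁ z + h₂ z² + h₃ z³`. -/
lemma normSq_toeplitz_le {w : ℂ → ℂ} (hw : DifferentiableOn ℂ w unitDisk)
    (hmaps : Set.MapsTo w unitDisk unitDisk) (hw0 : w 0 = 0) (h₁ h₂ h₃ : ℂ) :
    Complex.normSq (taylorCoeff w 1)
      + Complex.normSq (taylorCoeff w 2 + h₁ * taylorCoeff w 1)
      + Complex.normSq (taylorCoeff w 3 + h₁ * taylorCoeff w 2 + h₂ * taylorCoeff w 1)
      + Complex.normSq (taylorCoeff w 4 + h₁ * taylorCoeff w 3 + h₂ * taylorCoeff w 2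
          + h₃ * taylorCoeff w 1)
      ≤ 1 + Complex.normSq h₁ + Complex.normSq h₂ + Complex.normSq h₃ := by
  have hc0 : taylorCoeff w 0 = 0 := by simp [taylorCoeff, hw0]
  have h := sum_normSq_mul_polynomial_le hw hmaps
    (fun k => match k with | 0 => 1 | 1 => h₁ | 2 => h₂ | 3 => h₃ | _ => 0) 5
  simpa [Finset.sum_range_succ, hc0] using h

/-- A lower bound for `‖r + α p + β q‖² - ‖v r + s p + v β q‖²` that does not depend on `r`:
it is a quadratic in `r` whose minimum is `-(s - v α)² ‖p‖² / (1 - v²)`. -/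
lemma neg_mul_normSq_le {v s α β K : ℝ} (hv : v ^ 2 < 1)
    (hK : (s - v * α) ^ 2 ≤ K * (1 - v ^ 2)) (r p q : ℂ) :
    -(K * Complex.normSq p) ≤ Complex.normSq (r + α * p + β * q)
      - Complex.normSq (v * r + s * p + (v * β : ℝ) * q) := by
  have real : ∀ r p q : ℝ, -(K * p ^ 2) ≤ (r + α * p + β * q) ^ 2
      - (v * r + s * p + v * β * q) ^ 2 := by
    intro r p q
    have hv' : 0 < 1 - v ^ 2 := by linarith
    refine le_of_mul_le_mul_left ?_ hv'
    nlinarith [sq_nonneg ((r + α * p + β * q) - v * (v * r + s * p + v * β * q)),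
      mul_le_mul_of_nonneg_right hK (sq_nonneg p)]
  have h1 := real r.re p.re q.re
  have h2 := real r.im p.im q.im
  simp only [Complex.normSq_apply, Complex.add_re, Complex.add_im, Complex.mul_re, Complex.mul_im,
    Complex.ofReal_re, Complex.ofReal_im, zero_mul, sub_zero, add_zero]
  linarith

/-- Nonnegativity of the quadratic form
`(1 - x²) ‖q‖² + ‖p + x q‖² - ‖y p + u q‖² - K ‖p‖²`, by the determinant criterion. -/
lemma quadratic_normSq_nonneg {x y u K : ℝ} (ha : 0 < 1 - y ^ 2 - K)
    (hdet : (x - y * u) ^ 2 ≤ (1 - y ^ 2 - K) * (1 - u ^ 2)) (p q : ℂ) :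
    0 ≤ (1 - x ^ 2) * Complex.normSq q + Complex.normSq (p + x * q)
      - Complex.normSq (y * p + u * q) - K * Complex.normSq p := by
  have real : ∀ p q : ℝ, 0 ≤ (1 - x ^ 2) * q ^ 2 + (p + x * q) ^ 2
      - (y * p + u * q) ^ 2 - K * p ^ 2 := by
    intro p q
    refine nonneg_of_mul_nonneg_right ?_ ha
    nlinarith [sq_nonneg ((1 - y ^ 2 - K) * p + (x - y * u) * q),
      mul_le_mul_of_nonneg_right hdet (sq_nonneg q)]
  have h1 := real p.re q.re
  have h2 := real p.im q.im
  simp only [Complex.normSq_apply, Complex.add_re, Complex.add_im, Complex.mul_re, Complex.mul_im,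
    Complex.ofReal_re, Complex.ofReal_im, zero_mul, sub_zero, add_zero]
  linarith

lemma norm_le_one_of_normSq {z : ℂ} (h : Complex.normSq z ≤ 1) : ‖z‖ ≤ 1 := by
  rw [Complex.normSq_eq_norm_sq] at h
  exact (sq_le_one_iff₀ (norm_nonneg z)).mp h

section SchurFunction

variable {w : ℂ → ℂ} (hw : DifferentiableOn ℂ w unitDisk)
  (hmaps : Set.MapsTo w unitDisk unitDisk) (hw0 : w 0 = 0)

include hw hmaps hw0

lemma normSq_taylorCoeff_one_le : Complex.normSq (taylorCoeff w 1) ≤ 1 := by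
  have h := normSq_toeplitz_le hw hmaps hw0 0 0 0
  simp only [zero_mul, add_zero, map_zero] at h
  linarith [Complex.normSq_nonneg (taylorCoeff w 2), Complex.normSq_nonneg (taylorCoeff w 3),
    Complex.normSq_nonneg (taylorCoeff w 4)]

lemma norm_second_functional_le {A : ℝ} (hA : A ^ 2 ≤ 1) :
    ‖taylorCoeff w 2 + A * taylorCoeff w 1 ^ 2‖ ≤ 1 := by
  apply norm_le_one_of_normSq
  set c₁ := taylorCoeff w 1
  have h := normSq_toeplitz_le hw hmaps hw0 (A * c₁) 0 0
  rw [Complex.normSq_mul, Complex.normSq_ofReal, map_zero,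
    show taylorCoeff w 2 + A * c₁ * taylorCoeff w 1 = taylorCoeff w 2 + A * c₁ ^ 2 by ring] at h
  have h1 := mul_le_mul_of_nonneg_right hA (Complex.normSq_nonneg c₁)
  linarith [Complex.normSq_nonneg (taylorCoeff w 3 + A * c₁ * taylorCoeff w 2 + 0 * c₁),
    Complex.normSq_nonneg (taylorCoeff w 4 + A * c₁ * taylorCoeff w 3 + 0 * taylorCoeff w 2
      + 0 * c₁)]

/-- The functional is the top coefficient of `w · (1 + x c₁ z + (y c₂ + u c₁²) z²)`. -/
lemma norm_third_functional_le {x y u : ℝ} (hx : x ^ 2 ≤ 1) (hy : y ^ 2 < 1)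
    (hdet : (x - y * u) ^ 2 ≤ (1 - y ^ 2) * (1 - u ^ 2)) :
    ‖taylorCoeff w 3 + (x + y) * taylorCoeff w 1 * taylorCoeff w 2
      + u * taylorCoeff w 1 ^ 3‖ ≤ 1 := by
  apply norm_le_one_of_normSq
  have hc1 := normSq_taylorCoeff_one_le hw hmaps hw0
  set c₁ := taylorCoeff w 1
  set c₂ := taylorCoeff w 2
  set c₃ := taylorCoeff w 3
  have h := normSq_toeplitz_le hw hmaps hw0 (x * c₁) (y * c₂ + u * c₁ ^ 2) 0
  have h4 := Complex.normSq_nonneg (taylorCoeff w 4 + x * c₁ * c₃ + (y * c₂ + u * c₁ ^ 2) * c₂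
    + 0 * c₁)
  have hq := quadratic_normSq_nonneg (x := x) (y := y) (u := u) (K := 0) (by linarith)
    (by simpa using hdet) c₂ (c₁ ^ 2)
  rw [show c₃ + x * c₁ * c₂ + (y * c₂ + u * c₁ ^ 2) * c₁
      = c₃ + (x + y) * c₁ * c₂ + u * c₁ ^ 3 by ring,
    show c₂ + x * c₁ * c₁ = c₂ + x * c₁ ^ 2 by ring, map_zero,
    Complex.normSq_mul, Complex.normSq_ofReal] at h
  rw [map_pow] at hq
  have h5 : (1 - x ^ 2) * Complex.normSq c₁ ^ 2 ≤ (1 - x ^ 2) * Complex.normSq c₁ :=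
    mul_le_mul_of_nonneg_left (by nlinarith [Complex.normSq_nonneg c₁]) (by linarith)
  linarith

/-- The functional is the top coefficient of
`w · (1 + x c₁ z + (y c₂ + u c₁²) z² + (v c₃ + s c₁ c₂ + v u c₁³) z³)`. The hypotheses say that
the lower coefficients of this product compensate the coefficients of the second factor. -/
lemma norm_fourth_functional_le {x y u v s K : ℝ} (hx : x ^ 2 ≤ 1) (hv : v ^ 2 < 1)
    (hK0 : 0 ≤ K) (hK : (s - v * (x + y)) ^ 2 ≤ K * (1 - v ^ 2)) (ha : 0 < 1 - y ^ 2 - K)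
    (hdet : (x - y * u) ^ 2 ≤ (1 - y ^ 2 - K) * (1 - u ^ 2)) :
    ‖taylorCoeff w 4 + (x + v) * taylorCoeff w 1 * taylorCoeff w 3 + y * taylorCoeff w 2 ^ 2
      + (u + s) * taylorCoeff w 1 ^ 2 * taylorCoeff w 2
      + v * u * taylorCoeff w 1 ^ 4‖ ≤ 1 := by
  apply norm_le_one_of_normSq
  have hc1 := normSq_taylorCoeff_one_le hw hmaps hw0
  set c₁ := taylorCoeff w 1
  set c₂ := taylorCoeff w 2
  set c₃ := taylorCoeff w 3
  set c₄ := taylorCoeff w 4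
  have h := normSq_toeplitz_le hw hmaps hw0 (x * c₁) (y * c₂ + u * c₁ ^ 2)
    (v * c₃ + s * (c₁ * c₂) + (v * u : ℝ) * c₁ ^ 3)
  have hq := quadratic_normSq_nonneg ha hdet c₂ (c₁ ^ 2)
  have hr := neg_mul_normSq_le (α := x + y) (β := u) hv hK c₃ (c₁ * c₂) (c₁ ^ 3)
  rw [show c₄ + x * c₁ * c₃ + (y * c₂ + u * c₁ ^ 2) * c₂
        + (v * c₃ + s * (c₁ * c₂) + (v * u : ℝ) * c₁ ^ 3) * c₁
      = c₄ + (x + v) * c₁ * c₃ + y * c₂ ^ 2 + (u + s) * c₁ ^ 2 * c₂ + v * u * c₁ ^ 4 by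
      push_cast
      ring,
    show c₃ + x * c₁ * c₂ + (y * c₂ + u * c₁ ^ 2) * c₁
      = c₃ + (x + y : ℝ) * (c₁ * c₂) + u * c₁ ^ 3 by
      push_cast
      ring,
    show c₂ + x * c₁ * c₁ = c₂ + x * c₁ ^ 2 by ring,
    Complex.normSq_mul (x : ℂ), Complex.normSq_ofReal] at h
  rw [map_pow] at hq
  rw [Complex.normSq_mul c₁ c₂] at hr
  have h5 : (1 - x ^ 2) * Complex.normSq c₁ ^ 2 ≤ (1 - x ^ 2) * Complex.normSq c₁ :=
    mul_le_mul_of_nonneg_left (by nlinarith [Complex.normSq_nonneg c₁]) (by linarith)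
  have h6 : K * (Complex.normSq c₁ * Complex.normSq c₂) ≤ K * Complex.normSq c₂ :=
    mul_le_mul_of_nonneg_left (mul_le_of_le_one_left (Complex.normSq_nonneg _) hc1) hK0
  linarith

end SchurFunction

/-- The coefficient bounds, for a function `f` with `z f' = f · φ(w)`. -/
lemma norm_taylorCoeff_le {n : ℕ} (hn : 4 ≤ n) {f w : ℂ → ℂ}
    (hf : AnalyticAt ℂ f 0) (hf0 : f 0 = 0) (hf1 : deriv f 0 = 1)
    (hw : DifferentiableOn ℂ w unitDisk) (hmaps : Set.MapsTo w unitDisk unitDisk) (hw0 : w 0 = 0)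
    (h : ∀ᶠ z in nhds 0, z * deriv f z = f z * phi n (w z)) :
    ‖taylorCoeff f 2‖ ≤ (n : ℝ) / ((n : ℝ) + 1) ∧
    ‖taylorCoeff f 3‖ ≤ (n : ℝ) / (2 * ((n : ℝ) + 1)) ∧
    ‖taylorCoeff f 4‖ ≤ (n : ℝ) / (3 * ((n : ℝ) + 1)) ∧
    ‖taylorCoeff f 5‖ ≤ (n : ℝ) / (4 * ((n : ℝ) + 1)) := by
  have hn0 : (0 : ℝ) < (n : ℝ) + 1 := by positivity
  have hwa : AnalyticAt ℂ w 0 :=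
    hw.analyticAt (Metric.isOpen_ball.mem_nhds (Metric.mem_ball_self one_pos))
  obtain ⟨A, hA⟩ : ∃ A : ℝ, A = n / (n + 1) := ⟨_, rfl⟩
  obtain ⟨ε, hε⟩ : ∃ ε : ℝ, ε = if n = 4 then 1 / 4 else 0 := ⟨_, rfl⟩
  have hA0 : 0 ≤ A := by rw [hA]; positivity
  have hA1 : A ≤ 1 := by
    rw [hA, div_le_one hn0]
    linarith
  have hA2 : A ^ 2 ≤ 1 := pow_le_one₀ hA0 hA1
  have hA4 : A ^ 4 ≤ 1 := pow_le_one₀ hA0 hA1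
  obtain ⟨e2, e3, e4, e5⟩ := taylorCoeff_eq_of_mul_deriv_eq hn hf hf0 hf1 hwa hw0 h
    (A := (A : ℂ)) (ε := (ε : ℂ)) (by rw [hA]; push_cast; rfl)
    (by rw [hε]; split_ifs <;> push_cast <;> rfl)
  have scale : ∀ (d : ℝ) (_ : 0 < d) (F : ℂ), ‖F‖ ≤ 1 →
      ‖(A : ℂ) / (d : ℂ) * F‖ ≤ (n : ℝ) / (d * ((n : ℝ) + 1)) := by
    intro d hd F hF
    rw [norm_mul, norm_div, Complex.norm_real, Complex.norm_real, Real.norm_of_nonneg hA0,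
      Real.norm_of_nonneg hd.le]
    calc A / d * ‖F‖ ≤ A / d := mul_le_of_le_one_right (by positivity) hF
      _ = (n : ℝ) / (d * ((n : ℝ) + 1)) := by
        rw [hA]
        field_simp
  refine ⟨?_, ?_, ?_, ?_⟩
  · have := scale 1 one_pos _ (norm_le_one_of_normSq (normSq_taylorCoeff_one_le hw hmaps hw0))
    rw [e2]
    simpa using this
  · have := scale 2 two_pos _ (norm_second_functional_le hw hmaps hw0 hA2)
    rw [e3]
    simpa using this
  · have := scale 3 three_pos _ (norm_third_functional_le hw hmaps hw0
      (x := 3 / 4 * A) (y := 3 / 4 * A) (u := A ^ 2 / 2) (by nlinarith) (by nlinarith)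
      (by nlinarith [mul_nonneg hA0 hA0]))
    rw [e4]
    convert this using 3
    · norm_num
    · push_cast
      ring
  · rw [e5]
    rcases eq_or_ne n 4 with h4 | h4
    · -- Here `A = 4 / 5` and `ε = 1 / 4`; `u` solves `v u = A ^ 3 / 6 + ε`, and `s` solves
      -- `u + s = A ^ 2`.
      have hA' : A = 4 / 5 := by rw [hA, h4]; norm_num
      have := scale 4 four_pos _ (norm_fourth_functional_le hw hmaps hw0
        (x := 8 / 15) (y := 2 / 5) (v := 8 / 15) (u := 503 / 800) (s := 9 / 800) (K := 1 / 3)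
        (by norm_num) (by norm_num) (by norm_num) (by norm_num) (by norm_num) (by norm_num))
      convert this using 3
      · norm_num
      · rw [hε, if_pos h4, hA']
        push_cast
        ring
    · -- Here `ε = 0`; `u` solves `v u = A ^ 3 / 6` and `s` solves `u + s = A ^ 2`.
      have := scale 4 four_pos _ (norm_fourth_functional_le hw hmaps hw0
        (x := 2 / 3 * A) (y := A / 2) (v := 2 / 3 * A) (u := A ^ 2 / 4) (s := 3 / 4 * A ^ 2)
        (K := 1 / 100) (by nlinarith) (by nlinarith) (by norm_num) (by nlinarith) (by nlinarith)
        (by nlinarith))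
      convert this using 3
      · norm_num
      · rw [hε, if_neg h4]
        push_cast
        ring

/-! ### The extremal functions -/

lemma norm_phi_sub_one_le (n : ℕ) (hn : 1 ≤ n) {ζ : ℂ} (hζ : ‖ζ‖ ≤ 1) :
    ‖phi n ζ - 1‖ ≤ ‖ζ‖ := by
  have hn0 : (0 : ℝ) < (n : ℝ) + 1 := by positivity
  have e : phi n ζ - 1 = (n * ζ + ζ ^ n) / (((n : ℝ) + 1 : ℝ) : ℂ) := by
    rw [phi]
    push_cast
    ring
  rw [e, norm_div, Complex.norm_real, Real.norm_of_nonneg hn0.le, div_le_iff₀ hn0]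
  calc ‖n * ζ + ζ ^ n‖ ≤ n * ‖ζ‖ + ‖ζ‖ ^ n := by
        refine (norm_add_le _ _).trans (le_of_eq ?_)
        rw [norm_mul, norm_pow, Complex.norm_natCast]
    _ ≤ n * ‖ζ‖ + ‖ζ‖ := by
        gcongr
        exact pow_le_of_le_one (norm_nonneg _) hζ (by omega)
    _ = ‖ζ‖ * (n + 1) := by ring

/-- The primitive `∫₀ᶻ (φ(t ^ m) - 1) / t dt` in closed form. -/
noncomputable def exponent (n m : ℕ) (z : ℂ) : ℂ :=
  n / (n + 1) * z ^ m / m + 1 / (n + 1) * z ^ (m * n) / (m * n : ℕ)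

lemma hasDerivAt_exponent {n m : ℕ} (hn : 1 ≤ n) (hm : 1 ≤ m) (z : ℂ) :
    HasDerivAt (exponent n m) (n / (n + 1) * z ^ (m - 1) + 1 / (n + 1) * z ^ (m * n - 1)) z := by
  have hm0 : (m : ℂ) ≠ 0 := by exact_mod_cast (by omega : m ≠ 0)
  have hmn0 : ((m * n : ℕ) : ℂ) ≠ 0 := by
    exact_mod_cast Nat.mul_ne_zero (by omega) (by omega)
  have h := (((hasDerivAt_pow m z).const_mul (n / (n + 1) : ℂ)).div_const (m : ℂ)).add
    (((hasDerivAt_pow (m * n) z).const_mul (1 / (n + 1) : ℂ)).div_const ((m * n : ℕ) : ℂ))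
  refine HasDerivAt.congr_deriv h ?_
  field_simp

lemma mul_deriv_exponent {n m : ℕ} (hn : 1 ≤ n) (hm : 1 ≤ m) (z : ℂ) :
    z * (n / (n + 1) * z ^ (m - 1) + 1 / (n + 1) * z ^ (m * n - 1)) = phi n (z ^ m) - 1 := by
  have h1 : z * z ^ (m - 1) = z ^ m := mul_pow_sub_one (by omega) z
  have h2 : z * z ^ (m * n - 1) = (z ^ m) ^ n := by
    rw [← pow_mul]
    exact mul_pow_sub_one (Nat.mul_ne_zero (by omega) (by omega)) z
  rw [phi, ← h2, ← h1]
  ring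

lemma segmentIntegral_eq_exponent {n m : ℕ} (hn : 1 ≤ n) (hm : 1 ≤ m) (z : ℂ) :
    segmentIntegral (fun t => (phi n (t ^ m) - 1) / t) z = exponent n m z := by
  have hmn : m * n ≠ 0 := Nat.mul_ne_zero (by omega) (by omega)
  have hd : ∀ s ∈ Set.uIcc (0 : ℝ) 1, HasDerivAt (fun s : ℝ => exponent n m (s * z))
      ((n / (n + 1) * (s * z) ^ (m - 1) + 1 / (n + 1) * (s * z) ^ (m * n - 1)) * z) s := by
    intro s _
    have h1 : HasDerivAt (fun s : ℝ => (s : ℂ) * z) z s := by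
      simpa using (Complex.ofRealCLM.hasDerivAt (x := s)).mul_const z
    exact (hasDerivAt_exponent hn hm (s * z)).comp s h1
  have hint := intervalIntegral.integral_eq_sub_of_hasDerivAt hd
    (Continuous.intervalIntegrable (by fun_prop) _ _)
  have h0 : exponent n m 0 = 0 := by
    rw [exponent, zero_pow (by omega), zero_pow hmn]
    simp
  rw [Complex.ofReal_one, one_mul, Complex.ofReal_zero, zero_mul, h0, sub_zero] at hint
  rw [← hint, segmentIntegral]
  -- The two integrands can differ only at `s = 0`.
  refine intervalIntegral.integral_congr_ae (Filter.Eventually.of_forall fun s hs => ?_)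
  rw [Set.uIoc_of_le zero_le_one] at hs
  rcases eq_or_ne z 0 with rfl | hz
  · simp
  have hsz : (s : ℂ) * z ≠ 0 := mul_ne_zero (by exact_mod_cast hs.1.ne') hz
  rw [← mul_deriv_exponent hn hm, mul_div_cancel_left₀ _ hsz]

lemma extremal_eq {n m : ℕ} (hn : 1 ≤ n) (hm : 1 ≤ m) :
    extremal n (m + 1) = fun z => z * Complex.exp (exponent n m z) := by
  ext z
  rw [extremal, Nat.add_sub_cancel, segmentIntegral_eq_exponent hn hm]

lemma hasDerivAt_extremal {n m : ℕ} (hn : 1 ≤ n) (hm : 1 ≤ m) (z : ℂ) :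
    HasDerivAt (extremal n (m + 1)) (Complex.exp (exponent n m z) * phi n (z ^ m)) z := by
  rw [extremal_eq hn hm]
  have h := (hasDerivAt_id z).mul (hasDerivAt_exponent hn hm z).cexp
  refine HasDerivAt.congr_deriv h ?_
  rw [show phi n (z ^ m) = 1 + (phi n (z ^ m) - 1) by ring, ← mul_deriv_exponent hn hm]
  simp only [id]
  ring

/-- Univalence of the extremal functions. In the coordinate `z = exp u` on the left half-plane,
the logarithm of `z * exp (G z)` is `u + G (exp u)`, where `u ↦ G (exp u)` has derivative
`φ(z ^ m) - 1` of modulus less than `1`. Hence it is a strict contraction on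
every closed half-plane inside the left half-plane, and `u + G (exp u)` is injective. -/
lemma injOn_extremal {n m : ℕ} (hn : 1 ≤ n) (hm : 1 ≤ m) :
    Set.InjOn (extremal n (m + 1)) unitDisk := by
  rw [extremal_eq hn hm]
  intro z₁ h₁ z₂ h₂ heq
  simp only at heq
  rw [unitDisk, mem_ball_zero_iff] at h₁ h₂
  rcases eq_or_ne z₁ 0 with rfl | hz₁
  · rw [zero_mul, zero_eq_mul] at heq
    exact (heq.resolve_right (Complex.exp_ne_zero _)).symm
  rcases eq_or_ne z₂ 0 with rfl | hz₂
  · rw [zero_mul, mul_eq_zero] at heq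
    exact heq.resolve_right (Complex.exp_ne_zero _)
  obtain ⟨u₁, rfl⟩ : ∃ u, Complex.exp u = z₁ := ⟨_, Complex.exp_log hz₁⟩
  obtain ⟨v, rfl⟩ : ∃ u, Complex.exp u = z₂ := ⟨_, Complex.exp_log hz₂⟩
  rw [← Complex.exp_add, ← Complex.exp_add, Complex.exp_eq_exp_iff_exists_int] at heq
  obtain ⟨k, hk⟩ := heq
  -- Choose the logarithm of `z₂` that makes the logarithms of the two values equal.
  set u₂ := v + k * (2 * Real.pi * Complex.I) with hu₂
  have hexp : Complex.exp u₂ = Complex.exp v := by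
    rw [Complex.exp_eq_exp_iff_exists_int]
    exact ⟨k, rfl⟩
  rw [← hexp] at h₂ hk ⊢
  set ρ := max ‖Complex.exp u₁‖ ‖Complex.exp u₂‖ with hρ
  have hρ1 : ρ < 1 := max_lt h₁ h₂
  have hρ0 : 0 < ρ := lt_max_of_lt_left (norm_pos_iff.mpr (Complex.exp_ne_zero _))
  set s : Set ℂ := {u | u.re ≤ Real.log ρ} with hs
  have hmem : ∀ u, ‖Complex.exp u‖ ≤ ρ ↔ u ∈ s := by
    intro u
    rw [Complex.norm_exp, hs, Set.mem_ofPred_eq, Real.le_log_iff_exp_le hρ0]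
  have hconv : Convex ℝ s := convex_halfSpace_re_le _
  have hderiv : ∀ u ∈ s, HasDerivWithinAt (fun u => exponent n m (Complex.exp u))
      (phi n (Complex.exp u ^ m) - 1) s u := by
    intro u _
    have h := (hasDerivAt_exponent hn hm (Complex.exp u)).comp u (Complex.hasDerivAt_exp u)
    rw [mul_comm, mul_deriv_exponent hn hm] at h
    exact h.hasDerivWithinAt
  have hbound : ∀ u ∈ s, ‖phi n (Complex.exp u ^ m) - 1‖ ≤ ρ := by
    intro u hu
    have hu' := (hmem u).mpr hu
    have hu1 : ‖Complex.exp u‖ ≤ 1 := hu'.trans hρ1.le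
    have hle : ‖Complex.exp u ^ m‖ ≤ ‖Complex.exp u‖ := by
      rw [norm_pow]
      exact pow_le_of_le_one (norm_nonneg _) hu1 (by omega)
    exact ((norm_phi_sub_one_le n hn (hle.trans hu1)).trans hle).trans hu'
  have hlip := hconv.norm_image_sub_le_of_norm_hasDerivWithin_le hderiv hbound
    ((hmem u₂).mp (le_max_right _ _)) ((hmem u₁).mp (le_max_left _ _))
  have hdiff : exponent n m (Complex.exp u₁) - exponent n m (Complex.exp u₂) = -(u₁ - u₂) := by
    rw [hu₂] at hk ⊢
    linear_combination hk
  rw [hdiff, norm_neg] at hlip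
  have hzero : ‖u₁ - u₂‖ = 0 := by
    by_contra hne
    have hpos : 0 < ‖u₁ - u₂‖ := lt_of_le_of_ne (norm_nonneg _) (Ne.symm hne)
    nlinarith
  rw [sub_eq_zero.mp (norm_eq_zero.mp hzero)]

lemma extremal_zero {n m : ℕ} (hn : 1 ≤ n) (hm : 1 ≤ m) : extremal n (m + 1) 0 = 0 := by
  rw [extremal_eq hn hm]
  exact zero_mul _

lemma deriv_extremal_zero {n m : ℕ} (hn : 1 ≤ n) (hm : 1 ≤ m) :
    deriv (extremal n (m + 1)) 0 = 1 := by
  have hmn : m * n ≠ 0 := Nat.mul_ne_zero (by omega) (by omega)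
  rw [(hasDerivAt_extremal hn hm 0).deriv, exponent, phi, zero_pow (by omega), zero_pow hmn,
    zero_pow (by omega)]
  simp

lemma mul_deriv_extremal {n m : ℕ} (hn : 1 ≤ n) (hm : 1 ≤ m) (z : ℂ) :
    z * deriv (extremal n (m + 1)) z = extremal n (m + 1) z * phi n (z ^ m) := by
  rw [(hasDerivAt_extremal hn hm z).deriv, extremal_eq hn hm]
  ring

lemma differentiable_extremal {n m : ℕ} (hn : 1 ≤ n) (hm : 1 ≤ m) :
    Differentiable ℂ (extremal n (m + 1)) :=
  fun z => (hasDerivAt_extremal hn hm z).differentiableAt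

lemma extremal_mem_starlikeClass {n m : ℕ} (hn : 1 ≤ n) (hm : 1 ≤ m) :
    extremal n (m + 1) ∈ starlikeClass n := by
  refine ⟨⟨(differentiable_extremal hn hm).differentiableOn, injOn_extremal hn hm,
    extremal_zero hn hm, deriv_extremal_zero hn hm⟩, fun z => z ^ m, by fun_prop, ?_,
    zero_pow (by omega), ?_⟩
  · intro z hz
    rw [unitDisk, mem_ball_zero_iff] at hz ⊢
    rw [norm_pow]
    exact pow_lt_one₀ (norm_nonneg _) hz (by omega)
  · intro z _
    rw [starQuotient]
    split_ifs with h
    · have hm0 : m ≠ 0 := by omega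
      have hn0 : n ≠ 0 := by omega
      simp [h, phi, hm0, hn0]
    · have hne : extremal n (m + 1) z ≠ 0 := by
        rw [extremal_eq hn hm]
        exact mul_ne_zero h (Complex.exp_ne_zero _)
      rw [mul_deriv_extremal hn hm, mul_div_cancel_left₀ _ hne]

end EpicycloidStarlike

/-! ### The sharp coefficient bounds -/

open EpicycloidStarlike

theorem mainTheorem1 (n : ℕ) (hn : 4 ≤ n) (hn_even : Even n) :
    (∀ f ∈ EpicycloidStarlike.starlikeClass n,
      ‖EpicycloidStarlike.taylorCoeff f 2‖ ≤ (n : ℝ) / ((n : ℝ) + 1) ∧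
      ‖EpicycloidStarlike.taylorCoeff f 3‖ ≤ (n : ℝ) / (2 * ((n : ℝ) + 1)) ∧
      ‖EpicycloidStarlike.taylorCoeff f 4‖ ≤ (n : ℝ) / (3 * ((n : ℝ) + 1)) ∧
      ‖EpicycloidStarlike.taylorCoeff f 5‖ ≤ (n : ℝ) / (4 * ((n : ℝ) + 1))) ∧
    (∀ i ∈ Finset.Icc 2 5,
      EpicycloidStarlike.extremal n i ∈ EpicycloidStarlike.starlikeClass n) ∧
    ‖EpicycloidStarlike.taylorCoeff (EpicycloidStarlike.extremal n 2) 2‖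
      = (n : ℝ) / ((n : ℝ) + 1) ∧
    ‖EpicycloidStarlike.taylorCoeff (EpicycloidStarlike.extremal n 3) 3‖
      = (n : ℝ) / (2 * ((n : ℝ) + 1)) ∧
    ‖EpicycloidStarlike.taylorCoeff (EpicycloidStarlike.extremal n 4) 4‖
      = (n : ℝ) / (3 * ((n : ℝ) + 1)) ∧
    ‖EpicycloidStarlike.taylorCoeff (EpicycloidStarlike.extremal n 5) 5‖
      = (n : ℝ) / (4 * ((n : ℝ) + 1)) := by
  have hn1 : 1 ≤ n := by omega
  -- With `w = z ^ m` only the coefficient of index `m` of `w` is nonzero.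
  have coeffs : ∀ m, 1 ≤ m → _ := fun m hm =>
    taylorCoeff_eq_of_mul_deriv_eq hn ((differentiable_extremal hn1 hm).analyticAt 0)
      (extremal_zero hn1 hm) (deriv_extremal_zero hn1 hm)
      (w := fun z => z ^ m) (by fun_prop) (zero_pow (by omega))
      (Filter.Eventually.of_forall (mul_deriv_extremal hn1 hm)) rfl rfl
  have norm_eq : ∀ d : ℕ, ‖(n : ℂ) / (n + 1) / d‖ = (n : ℝ) / (d * ((n : ℝ) + 1)) := by
    intro d
    rw [show (n : ℂ) / (n + 1) / d = ((n / (d * (n + 1)) : ℝ) : ℂ) by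
      push_cast
      rw [div_div, mul_comm], Complex.norm_real, Real.norm_of_nonneg (by positivity)]
  refine ⟨?_, ?_, ?_, ?_, ?_, ?_⟩
  · rintro f ⟨hf, w, hw, hmaps, hw0, hfw⟩
    have hfa : AnalyticAt ℂ f 0 :=
      hf.analytic.analyticAt (Metric.isOpen_ball.mem_nhds (Metric.mem_ball_self one_pos))
    exact norm_taylorCoeff_le hn hfa hf.map_zero hf.deriv_zero hw hmaps hw0
      (eventually_mul_deriv_eq hf hfw)
  · intro i hi
    obtain ⟨m, rfl⟩ : ∃ m, i = m + 1 := ⟨i - 1, by have := Finset.mem_Icc.mp hi; omega⟩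
    exact extremal_mem_starlikeClass hn1 (by have := Finset.mem_Icc.mp hi; omega)
  · rw [(coeffs 1 le_rfl).1, taylorCoeff_pow, if_pos rfl]
    simpa using norm_eq 1
  · rw [(coeffs 2 (by norm_num)).2.1]
    simpa [taylorCoeff_pow] using norm_eq 2
  · rw [(coeffs 3 (by norm_num)).2.2.1]
    simpa [taylorCoeff_pow] using norm_eq 3
  · rw [(coeffs 4 (by norm_num)).2.2.2]
    simpa [taylorCoeff_pow] using norm_eq 4
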